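/- Let $M,N\ge 1$ be integers with $MN\ge 2$. For a compact set $\mathcal W\subset\{w\in\mathbb C:|w|\le 1\}$ and $h=(h_1,\dots,h_N)\in\mathbb C^N$ put $$g_{\mathcal W}(h)=\max_{w_1,\dots,w_N\in\mathcal W}\Big|\sum_{n=1}^N w_nh_n\Big|,\qquad g_{\rm ideal}(h)=\sum_{n=1}^N|h_n| ,$$ and let $\mathcal W_M=\{e^{2\pi i k/M}:k=0,\dots,M-1\}$ be the regular $M$-gon. The perimeter of a convex polygon is the sum of the lengths of its edges; a line segment is a polygon with $2$ vertices, whose perimeter is twice its length, and a point is a polygon with $1$ vertex and perimeter $0$. (a) If $\operatorname{Conv}\mathcal W$ is a polygon with $M$ vertices, then for all $h_1,\dots,h_N\in\mathbb C$ $$g_{\mathcal W}(h)\ \ge\ \frac{\text{perimeter of }\operatorname{Conv}\mathcal W}{\text{perimeter of }\operatorname{Conv}\mathcal W_{MN}}\; g_{\rm ideal}(h),\qquad\text{where}\quad \text{perimeter of }\operatorname{Conv}\mathcal W_{MN}=2MN\sin\frac{\pi}{MN}.$$ If $M\ge 2$, this constant is strictly larger than $\dfrac{\text{perimeter of }\operatorname{Conv}\mathcal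 W}{2\pi}$. (b) For $\mathcal W=\mathcal W_M$ the constant in (a) equals $\dfrac{\sin(\pi/M)}{N\sin(\pi/(MN))}$ and cannot be improved: it is the largest real $c$ such that $g_{\mathcal W_M}(h)\ge c\,g_{\rm ideal}(h)$ for all $h\in\mathbb C^N$. -/

import Mathlib

namespace Beamforming

noncomputable section

/-- `P` is a (filled, convex) polygon with exactly `M` vertices: it is the convex hull of `M` points,
and these points are its extreme points. For `M = 2` this is a line segment,
for `M = 1` a single point. -/
def IsPolygon (P : Set ℂ) (M : ℕ) : Prop :=
  ∃ V : Finset ℂ, V.card = M ∧ P = convexHull ℝ (V : Set ℂ) ∧ Set.extremePoints ℝ P = V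

/-- The edges of a convex polygon `P`, oriented counterclockwise: ordered pairs `(a, b)` of
distinct vertices such that all of `P` lies on the left of the directed line from `a` to `b`
(or on it). An edge of a polygon with nonempty interior occurs with exactly one orientation;
a line segment is the degenerate polygon with the two edges `(a, b)` and `(b, a)`. -/
def edges (P : Set ℂ) : Set (ℂ × ℂ) :=
  {e | e.1 ∈ Set.extremePoints ℝ P ∧ e.2 ∈ Set.extremePoints ℝ P ∧ e.1 ≠ e.2 ∧
    ∀ z ∈ P, 0 ≤ ((starRingEnd ℂ) (e.2 - e.1) * (z - e.1)).im}

/-- The perimeter of a convex polygon: the sum of the lengths of its edges. In particular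
the perimeter of a line segment is twice its length and that of a point is `0`. -/
def perimeter (P : Set ℂ) : ℝ :=
  ∑ᶠ e ∈ edges P, ‖e.2 - e.1‖

/-- The regular `M`-gon `{exp (2πik/M) : k = 0, …, M - 1}` (its set of vertices). -/
def regularGon (M : ℕ) : Set ℂ :=
  Set.range fun k : Fin M => Complex.exp (2 * Real.pi * ((k : ℕ) : ℂ) / (M : ℂ) * Complex.I)

/-- The values of `|∑ wₙ hₙ|` over all `w ∈ W ^ N`. -/
def gainValues {N : ℕ} (W : Set ℂ) (h : Fin N → ℂ) : Set ℝ :=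
  (fun w : Fin N → ℂ => ‖∑ n, w n * h n‖) '' {w | ∀ n, w n ∈ W}

/-- The maximum of `|∑ wₙ hₙ|` over `w ∈ W ^ N`. -/
def gain {N : ℕ} (W : Set ℂ) (h : Fin N → ℂ) : ℝ :=
  sSup (gainValues W h)

/-- The gain with ideal phase shifters, `∑ |hₙ|`. -/
def idealGain {N : ℕ} (h : Fin N → ℂ) : ℝ :=
  ∑ n, ‖h n‖

/-- For a nonempty compact `W` the maximum defining `gain W h` is attained. -/
theorem isGreatest_gain {N : ℕ} {W : Set ℂ} (hW : IsCompact W) (hne : W.Nonempty)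
    (h : Fin N → ℂ) : IsGreatest (gainValues W h) (gain W h) := by
  obtain ⟨x, hx⟩ := hne
  have hc : IsCompact {w : Fin N → ℂ | ∀ n, w n ∈ W} := isCompact_pi_infinite fun _ => hW
  have hi : IsCompact (gainValues W h) := hc.image (by fun_prop)
  exact hi.isGreatest_sSup ⟨_, fun _ => x, fun _ => hx, rfl⟩

end

end Beamforming

/-! Lower bound. For each `n`, rotate the outer edge normals of `Conv W` by `arg (h n)`. A polygon
with `M` vertices has at most `M` edges, so all these directions together cut the circle into `K ≤ M
* N` arcs. On each arc, every rotated polygon has one vertex that is extremal throughout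
(`exists_common_maximizer`). Integrating support functions arc by arc gives a discrete Cauchy
formula: the perimeter is at most the sum of `2 sin (gap / 2)` times the support value of that
vertex in the middle direction of the arc (`perimeter_le_sum`). Weight this by `‖h n‖` and sum over
`n`. On each arc the selected vertices form an admissible `w`, so the combined support value is at
most the gain. The half-gaps sum to `π`, and concavity of sine bounds the remaining factor by `2 M N
sin (π / (M N))` (`sum_sin_half_le`, `perimeter_mul_idealGain_le`). Strictness against `2π` is `sin
x < x`. Sharpness. Take `h n = exp (2πi n / (M N))`. Each `w n * h n` then ranges over one coset of
the `M`-th roots of unity among the `M N`-th roots, and the longest sum of one element per coset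
comes from `N` consecutive roots (`norm_sum_gonVertex_coset_le`), a geometric sum. -/

namespace Beamforming

/-! ### Coordinates in a rotating orthonormal frame -/

/-- The component of `z` in the direction `exp (θ * I)`. -/
noncomputable def normalPart (θ : ℝ) (z : ℂ) : ℝ := z.re * Real.cos θ + z.im * Real.sin θ

/-- The component of `z` in the direction `I * exp (θ * I)`. -/
noncomputable def tangentPart (θ : ℝ) (z : ℂ) : ℝ := z.im * Real.cos θ - z.re * Real.sin θ

theorem normalPart_sub (θ : ℝ) (z w : ℂ) :
    normalPart θ (z - w) = normalPart θ z - normalPart θ w := by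
  simp only [normalPart, Complex.sub_re, Complex.sub_im]; ring

theorem tangentPart_sub (θ : ℝ) (z w : ℂ) :
    tangentPart θ (z - w) = tangentPart θ z - tangentPart θ w := by
  simp only [tangentPart, Complex.sub_re, Complex.sub_im]; ring

theorem normalPart_sq_add_tangentPart_sq (θ : ℝ) (z : ℂ) :
    normalPart θ z ^ 2 + tangentPart θ z ^ 2 = ‖z‖ ^ 2 := by
  rw [Complex.sq_norm, Complex.normSq_apply, normalPart, tangentPart]
  linear_combination (z.re ^ 2 + z.im ^ 2) * Real.sin_sq_add_cos_sq θ

theorem normalPart_eq_rotate (φ ψ : ℝ) (z : ℂ) :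
    normalPart φ z =
      normalPart ψ z * Real.cos (ψ - φ) - tangentPart ψ z * Real.sin (ψ - φ) := by
  rw [Real.cos_sub, Real.sin_sub, normalPart, normalPart, tangentPart]
  linear_combination -(z.re * Real.cos φ + z.im * Real.sin φ) * Real.sin_sq_add_cos_sq ψ

theorem tangentPart_eq_rotate (φ ψ : ℝ) (z : ℂ) :
    tangentPart φ z =
      tangentPart ψ z * Real.cos (ψ - φ) + normalPart ψ z * Real.sin (ψ - φ) := by
  rw [Real.cos_sub, Real.sin_sub, tangentPart, normalPart, tangentPart]
  linear_combination (-z.im * Real.cos φ + z.re * Real.sin φ) * Real.sin_sq_add_cos_sq ψ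

theorem normalPart_add_two_pi (θ : ℝ) (z : ℂ) :
    normalPart (θ + 2 * Real.pi) z = normalPart θ z := by
  simp [normalPart]

theorem tangentPart_add_two_pi (θ : ℝ) (z : ℂ) :
    tangentPart (θ + 2 * Real.pi) z = tangentPart θ z := by
  simp [tangentPart]

theorem im_conj_mul (θ : ℝ) (x y : ℂ) :
    ((starRingEnd ℂ) x * y).im =
      normalPart θ x * tangentPart θ y - tangentPart θ x * normalPart θ y := by
  simp only [normalPart, tangentPart, Complex.mul_im, Complex.conj_re, Complex.conj_im]
  linear_combination -(x.re * y.im - x.im * y.re) * Real.sin_sq_add_cos_sq θ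

theorem normalPart_le_norm (θ : ℝ) (z : ℂ) : normalPart θ z ≤ ‖z‖ := by
  have := normalPart_sq_add_tangentPart_sq θ z
  exact le_of_sq_le_sq (by nlinarith [sq_nonneg (tangentPart θ z)]) (norm_nonneg z)

theorem norm_eq_tangentPart {θ : ℝ} {z : ℂ} (h0 : normalPart θ z = 0)
    (h1 : 0 < tangentPart θ z) : ‖z‖ = tangentPart θ z := by
  have := normalPart_sq_add_tangentPart_sq θ z
  rw [h0] at this
  nlinarith [norm_nonneg z]

/-- Integrating the normal component of `p` over an interval of angles. -/
theorem two_sin_mul_normalPart (a b : ℝ) (p : ℂ) :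
    2 * Real.sin ((b - a) / 2) * normalPart ((a + b) / 2) p =
      tangentPart a p - tangentPart b p := by
  obtain ⟨x, y, rfl, rfl⟩ : ∃ x y : ℝ, a = x - y ∧ b = x + y :=
    ⟨(a + b) / 2, (b - a) / 2, by ring, by ring⟩
  rw [show (x + y - (x - y)) / 2 = y by ring, show (x - y + (x + y)) / 2 = x by ring]
  simp only [normalPart, tangentPart, Real.cos_sub, Real.sin_sub, Real.cos_add, Real.sin_add]
  ring

/-- In the frame at `m`, the argument of `z` can be taken in `[π/2, 3π/2]`; turning `m` by that
argument minus `π/2` makes `z` point along the tangent. -/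
theorem exists_angle_of_normalPart_nonpos {m : ℝ} {z : ℂ} (hz : z ≠ 0)
    (h : normalPart m z ≤ 0) :
    ∃ ψ ∈ Set.Icc m (m + Real.pi), normalPart ψ z = 0 ∧ 0 < tangentPart ψ z := by
  have hn : 0 < ‖z‖ := norm_pos_iff.2 hz
  have hsq := normalPart_sq_add_tangentPart_sq m z
  set r := ‖z‖
  set X := normalPart m z
  set Y := tangentPart m z
  have hY : |Y| ≤ r := abs_le_of_sq_le_sq (by nlinarith [sq_nonneg X]) hn.le
  have hY1 := abs_le.1 hY
  have hc : Real.cos (Real.arccos (Y / r)) = Y / r :=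
    Real.cos_arccos (by rw [le_div_iff₀ hn]; linarith) (by rw [div_le_iff₀ hn]; linarith)
  have hs : Real.sin (Real.arccos (Y / r)) = -X / r := by
    rw [Real.sin_arccos, Real.sqrt_eq_iff_mul_self_eq _ (by apply div_nonneg <;> linarith)]
    · field_simp
      linarith
    · have : (Y / r) ^ 2 ≤ 1 := by
        rw [div_pow, div_le_one (by positivity)]; nlinarith [sq_nonneg X]
      linarith
  refine ⟨m + Real.arccos (Y / r), ⟨by linarith [Real.arccos_nonneg (Y / r)],
    by linarith [Real.arccos_le_pi (Y / r)]⟩, ?_, ?_⟩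
  · rw [normalPart_eq_rotate _ m, show m - (m + Real.arccos (Y / r)) = -Real.arccos (Y / r) by ring,
      Real.cos_neg, Real.sin_neg, hc, hs]
    change X * (Y / r) - Y * -(-X / r) = 0
    ring
  · rw [tangentPart_eq_rotate _ m,
      show m - (m + Real.arccos (Y / r)) = -Real.arccos (Y / r) by ring,
      Real.cos_neg, Real.sin_neg, hc, hs]
    change 0 < Y * (Y / r) + X * -(-X / r)
    have : Y * (Y / r) + X * -(-X / r) = r := by field_simp; linarith
    linarith

theorem normalPart_conj (θ : ℝ) (z : ℂ) :
    normalPart (-θ) ((starRingEnd ℂ) z) = normalPart θ z := by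
  simp [normalPart]

theorem tangentPart_conj (θ : ℝ) (z : ℂ) :
    tangentPart (-θ) ((starRingEnd ℂ) z) = -tangentPart θ z := by
  simp [tangentPart]; ring

theorem exists_angle_of_normalPart_nonpos' {m : ℝ} {z : ℂ} (hz : z ≠ 0)
    (h : normalPart m z ≤ 0) :
    ∃ ψ ∈ Set.Icc (m - Real.pi) m, normalPart ψ z = 0 ∧ tangentPart ψ z < 0 := by
  obtain ⟨ψ, ⟨h1, h2⟩, h3, h4⟩ := exists_angle_of_normalPart_nonpos (m := -m)
    (z := (starRingEnd ℂ) z) (by simpa using hz) (by rwa [normalPart_conj])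
  refine ⟨-ψ, ⟨by linarith, by linarith⟩, ?_, ?_⟩
  · rw [← normalPart_conj, neg_neg, h3]
  · have := tangentPart_conj (-ψ) z
    rw [neg_neg] at this
    linarith

theorem normalPart_le_of_mem_convexHull {V : Set ℂ} {θ : ℝ} {p : ℂ}
    (h : ∀ z ∈ V, normalPart θ (z - p) ≤ 0) :
    ∀ z ∈ convexHull ℝ V, normalPart θ (z - p) ≤ 0 := by
  have hl : IsLinearMap ℝ (normalPart θ) :=
    ⟨fun x y => by simp only [normalPart, Complex.add_re, Complex.add_im]; ring,
     fun c x => by simp only [normalPart, Complex.smul_re, Complex.smul_im, smul_eq_mul]; ring⟩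
  have hc : Convex ℝ {z | normalPart θ z ≤ normalPart θ p} := convex_halfSpace_le hl _
  intro z hz
  have := convexHull_min (fun z hz => ?_) hc hz
  · rw [normalPart_sub]; linarith [Set.mem_ofPred.1 this]
  · have := h z hz
    rw [normalPart_sub] at this
    exact Set.mem_ofPred.2 (by linarith)

/-! ### Edges, outer normals and extremal vertices -/

/-- `φ` is the angle of the outer normal of a segment with direction `v`. -/
def IsNormalAngle (v : ℂ) (φ : ℝ) : Prop := normalPart φ v = 0 ∧ 0 < tangentPart φ v

/-- Lying to the left of an edge means not exceeding it in its outer normal direction, a linear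
condition that need only be tested on the vertices. -/
theorem mem_edges_iff {V : Finset ℂ} (hV : Set.extremePoints ℝ (convexHull ℝ (V : Set ℂ)) = V)
    {a b : ℂ} {φ : ℝ} (hφ : IsNormalAngle (b - a) φ) :
    (a, b) ∈ edges (convexHull ℝ (V : Set ℂ)) ↔
      a ∈ V ∧ b ∈ V ∧ ∀ z ∈ V, normalPart φ (z - a) ≤ 0 := by
  have key : ∀ z, 0 ≤ ((starRingEnd ℂ) (b - a) * (z - a)).im ↔ normalPart φ (z - a) ≤ 0 := by
    intro z
    rw [im_conj_mul φ, hφ.1, zero_mul, zero_sub, neg_nonneg, mul_nonpos_iff_pos_imp_nonpos]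
    have := hφ.2
    constructor
    · intro h; exact h.1 this
    · intro h; exact ⟨fun _ => h, fun _ => this.le⟩
  have hne : a ≠ b := by
    rintro rfl
    have := hφ.2
    simp [tangentPart] at this
  simp only [edges, Set.mem_ofPred_eq, hV, Finset.mem_coe, key]
  constructor
  · rintro ⟨h1, h2, -, h3⟩
    exact ⟨h1, h2, fun z hz => h3 z (subset_convexHull ℝ _ hz)⟩
  · rintro ⟨h1, h2, h3⟩
    exact ⟨h1, h2, hne, normalPart_le_of_mem_convexHull h3⟩

/-- Turn the direction counterclockwise from `m`: `p` stays extremal until the first moment at which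
another vertex ties with it, and that vertex ends the edge leaving `p`. -/
theorem exists_edge_after {V : Finset ℂ}
    (hV : Set.extremePoints ℝ (convexHull ℝ (V : Set ℂ)) = V) (hc : 2 ≤ V.card) {p : ℂ}
    (hp : p ∈ V) {m : ℝ} (hm : ∀ z ∈ V, normalPart m (z - p) ≤ 0) :
    ∃ b ψ, (p, b) ∈ edges (convexHull ℝ (V : Set ℂ)) ∧ IsNormalAngle (b - p) ψ ∧ m ≤ ψ ∧
      ∀ φ ∈ Set.Icc m ψ, ∀ z ∈ V, normalPart φ (z - p) ≤ 0 := by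
  have H : ∀ z ∈ V.erase p, ∃ ψ ∈ Set.Icc m (m + Real.pi),
      normalPart ψ (z - p) = 0 ∧ 0 < tangentPart ψ (z - p) := fun z hz =>
    exists_angle_of_normalPart_nonpos (sub_ne_zero.2 (Finset.ne_of_mem_erase hz))
      (hm z (Finset.mem_of_mem_erase hz))
  choose! ψ hψ using H
  have hne : (V.erase p).Nonempty := by
    rw [← Finset.card_pos, Finset.card_erase_of_mem hp]; omega
  -- `ψ z` is the angle at which `z` ties with `p`; the smallest one is met first.
  obtain ⟨b, hb, hmin⟩ := Finset.exists_min_image _ ψ hne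
  have hall : ∀ φ ∈ Set.Icc m (ψ b), ∀ z ∈ V, normalPart φ (z - p) ≤ 0 := by
    intro φ hφ z hz
    rcases eq_or_ne z p with rfl | hzp
    · simp [normalPart]
    have hz' := Finset.mem_erase.2 ⟨hzp, hz⟩
    rw [normalPart_eq_rotate φ (ψ z), (hψ z hz').2.1, zero_mul, zero_sub, neg_nonpos]
    refine mul_nonneg (hψ z hz').2.2.le (Real.sin_nonneg_of_nonneg_of_le_pi ?_ ?_)
    · linarith [hmin z hz', hφ.2]
    · linarith [(hψ z hz').1.2, hφ.1]
  have hm' := (hψ b hb).1.1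
  exact ⟨b, ψ b, (mem_edges_iff hV (hψ b hb).2).2 ⟨hp, Finset.mem_of_mem_erase hb,
    hall _ ⟨hm', le_rfl⟩⟩, (hψ b hb).2, hm', hall⟩

theorem exists_edge_before {V : Finset ℂ}
    (hV : Set.extremePoints ℝ (convexHull ℝ (V : Set ℂ)) = V) (hc : 2 ≤ V.card) {p : ℂ}
    (hp : p ∈ V) {m : ℝ} (hm : ∀ z ∈ V, normalPart m (z - p) ≤ 0) :
    ∃ a ψ, (a, p) ∈ edges (convexHull ℝ (V : Set ℂ)) ∧ IsNormalAngle (p - a) ψ ∧ ψ ≤ m ∧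
      ∀ φ ∈ Set.Icc ψ m, ∀ z ∈ V, normalPart φ (z - p) ≤ 0 := by
  have H : ∀ z ∈ V.erase p, ∃ ψ ∈ Set.Icc (m - Real.pi) m,
      normalPart ψ (z - p) = 0 ∧ tangentPart ψ (z - p) < 0 := fun z hz =>
    exists_angle_of_normalPart_nonpos' (sub_ne_zero.2 (Finset.ne_of_mem_erase hz))
      (hm z (Finset.mem_of_mem_erase hz))
  choose! ψ hψ using H
  have hne : (V.erase p).Nonempty := by
    rw [← Finset.card_pos, Finset.card_erase_of_mem hp]; omega
  obtain ⟨a, ha, hmax⟩ := Finset.exists_max_image _ ψ hne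
  have hall : ∀ φ ∈ Set.Icc (ψ a) m, ∀ z ∈ V, normalPart φ (z - p) ≤ 0 := by
    intro φ hφ z hz
    rcases eq_or_ne z p with rfl | hzp
    · simp [normalPart]
    have hz' := Finset.mem_erase.2 ⟨hzp, hz⟩
    rw [normalPart_eq_rotate φ (ψ z), (hψ z hz').2.1, zero_mul, zero_sub, neg_nonpos]
    refine mul_nonneg_of_nonpos_of_nonpos (hψ z hz').2.2.le
      (Real.sin_nonpos_of_nonpos_of_neg_pi_le ?_ ?_)
    · linarith [hmax z hz', hφ.1]
    · linarith [(hψ z hz').1.1, hφ.2]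
  obtain ⟨⟨-, hm'⟩, h0, h1⟩ := hψ a ha
  have hang : IsNormalAngle (p - a) (ψ a) := by
    rw [normalPart_sub] at h0
    rw [tangentPart_sub] at h1
    constructor
    · rw [normalPart_sub]; linarith
    · rw [tangentPart_sub]; linarith
  refine ⟨a, ψ a, (mem_edges_iff hV hang).2 ⟨Finset.mem_of_mem_erase ha, hp, fun z hz => ?_⟩,
    hang, hm', hall⟩
  have h2 := hall _ ⟨le_rfl, hm'⟩ z hz
  rw [normalPart_sub] at h0 h2 ⊢
  linarith

/-- If no edge has its normal in an open interval, then a single vertex is extremal for all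
directions in the closed interval. -/
theorem exists_common_maximizer {V : Finset ℂ}
    (hV : Set.extremePoints ℝ (convexHull ℝ (V : Set ℂ)) = V) (hc : 2 ≤ V.card) {s t : ℝ}
    (_hst : s < t) (hno : ∀ φ ∈ Set.Ioo s t, ∀ e ∈ edges (convexHull ℝ (V : Set ℂ)),
      ¬ IsNormalAngle (e.2 - e.1) φ) :
    ∃ p ∈ V, ∀ φ ∈ Set.Icc s t, ∀ z ∈ V, normalPart φ (z - p) ≤ 0 := by
  have hne : V.Nonempty := Finset.card_pos.1 (by omega)
  obtain ⟨p, hp, hmax⟩ := Finset.exists_max_image V (normalPart ((s + t) / 2)) hne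
  have hm : ∀ z ∈ V, normalPart ((s + t) / 2) (z - p) ≤ 0 := fun z hz => by
    rw [normalPart_sub]; linarith [hmax z hz]
  obtain ⟨b, ψ, hb, hbψ, hmψ, hafter⟩ := exists_edge_after hV hc hp hm
  obtain ⟨a, χ, ha, haχ, hmχ, hbefore⟩ := exists_edge_before hV hc hp hm
  have h1 : t ≤ ψ := by
    by_contra! h
    exact hno ψ ⟨by linarith, h⟩ _ hb hbψ
  have h2 : χ ≤ s := by
    by_contra! h
    exact hno χ ⟨h, by linarith⟩ _ ha haχ
  refine ⟨p, hp, fun φ hφ => ?_⟩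
  rcases le_total φ ((s + t) / 2) with h | h
  · exact hbefore φ ⟨by linarith [hφ.1], h⟩
  · exact hafter φ ⟨h, by linarith [hφ.2]⟩

/-- Of three distinct collinear points one lies strictly between the others, hence is not extreme;
the sign of `t` and its comparison with `1` tell which. -/
theorem eq_or_eq_of_collinear {P : Set ℂ} {x y z : ℂ} (hx : x ∈ Set.extremePoints ℝ P)
    (hy : y ∈ Set.extremePoints ℝ P) (hz : z ∈ Set.extremePoints ℝ P) (hxy : x ≠ y) {t : ℝ}
    (ht : z - x = t * (y - x)) : z = x ∨ z = y := by
  have hzt : z = x + t * (y - x) := by rw [← ht]; ring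
  by_contra! hcon
  rcases lt_trichotomy t 0 with h | h | h
  · have hm : x ∈ openSegment ℝ z y := by
      refine ⟨1 / (1 - t), -t / (1 - t), by apply div_pos <;> linarith,
        by apply div_pos <;> linarith, by field_simp [show (1 : ℝ) - t ≠ 0 by linarith]; ring, ?_⟩
      have : (1 : ℂ) - t ≠ 0 := by
        rw [← Complex.ofReal_one, ← Complex.ofReal_sub, Complex.ofReal_ne_zero]; linarith
      rw [hzt, Complex.real_smul, Complex.real_smul]
      push_cast
      field_simp
      ring
    have := (mem_extremePoints.1 hx).2 z hz.1 y hy.1 hm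
    exact hcon.1 this.1
  · rw [h] at hzt
    exact hcon.1 (by simpa using hzt)
  · rcases lt_trichotomy t 1 with h1 | h1 | h1
    · have hm : z ∈ openSegment ℝ x y := by
        refine ⟨1 - t, t, by linarith, h, by ring, ?_⟩
        rw [hzt, Complex.real_smul, Complex.real_smul]
        push_cast
        ring
      exact hcon.1 ((mem_extremePoints.1 hz).2 x hx.1 y hy.1 hm).1.symm
    · rw [h1] at hzt
      exact hcon.2 (by simpa using hzt)
    · have hm : y ∈ openSegment ℝ x z := by
        refine ⟨1 - 1 / t, 1 / t, ?_, by positivity, by ring, ?_⟩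
        · rw [sub_pos, div_lt_one h]; exact h1
        have : (t : ℂ) ≠ 0 := by rw [Complex.ofReal_ne_zero]; linarith
        rw [hzt, Complex.real_smul, Complex.real_smul]
        push_cast
        field_simp
        ring
      exact hxy ((mem_extremePoints.1 hy).2 x hx.1 z hz.1 hm).1

theorem exists_real_mul_of_im_conj_mul_eq_zero {v w : ℂ} (hv : v ≠ 0)
    (h : ((starRingEnd ℂ) v * w).im = 0) : ∃ t : ℝ, w = t * v := by
  refine ⟨((starRingEnd ℂ) v * w).re / Complex.normSq v, ?_⟩
  have h1 : ((((starRingEnd ℂ) v * w).re : ℝ) : ℂ) = (starRingEnd ℂ) v * w :=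
    Complex.ext (by simp) (by rw [h]; simp)
  have h2 : (Complex.normSq v : ℂ) ≠ 0 := by simpa using hv
  rw [Complex.ofReal_div, h1, div_mul_eq_mul_div, eq_div_iff h2, ← Complex.mul_conj]
  ring

/-- The ends of two edges leaving the same vertex lie to the left of each other's edge, so all three
points are collinear. This bounds the number of edges by the number of vertices. -/
theorem edges_fst_injOn (P : Set ℂ) : Set.InjOn Prod.fst (edges P) := by
  rintro ⟨a, b⟩ ⟨ha, hb, hab, h1⟩ ⟨a', c⟩ ⟨-, hc, hac, h2⟩ (rfl : a = a')
  simp only at ha hb hc hab hac h1 h2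
  have h3 := h1 c hc.1
  have h4 := h2 b hb.1
  obtain ⟨t, ht⟩ := exists_real_mul_of_im_conj_mul_eq_zero (sub_ne_zero.2 hab.symm)
    (w := c - a) (by
      refine le_antisymm ?_ h3
      simp only [Complex.mul_im, Complex.conj_re, Complex.conj_im] at h4 ⊢
      linarith)
  rcases eq_or_eq_of_collinear ha hb hc hab ht with h | h
  · exact absurd h.symm hac
  · rw [h]

/-- Both edges lie on the same supporting line, which contains only two extreme points; the common
normal fixes their order. -/
theorem edges_eq_of_isNormalAngle {P : Set ℂ} {e f : ℂ × ℂ} (he : e ∈ edges P) (hf : f ∈ edges P)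
    {φ : ℝ} (h1 : IsNormalAngle (e.2 - e.1) φ) (h2 : IsNormalAngle (f.2 - f.1) φ) : e = f := by
  obtain ⟨a, b⟩ := e
  obtain ⟨c, d⟩ := f
  obtain ⟨ha, hb, hab, hP⟩ := he
  obtain ⟨hc, hd, hcd, hP'⟩ := hf
  simp only [IsNormalAngle] at *
  have hle := hP c hc.1
  have hle' := hP' a ha.1
  have h3 : ((starRingEnd ℂ) (b - a) * (c - a)).im = 0 := by
    rw [im_conj_mul φ, h1.1, zero_mul, zero_sub] at hle ⊢
    rw [im_conj_mul φ, h2.1, zero_mul, zero_sub] at hle'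
    rw [normalPart_sub] at hle hle' ⊢
    have e1 : normalPart φ c - normalPart φ a = 0 := by
      refine le_antisymm ?_ ?_
      · by_contra! hh; nlinarith [mul_pos h1.2 hh]
      · by_contra! hh
        have : 0 < normalPart φ a - normalPart φ c := by linarith
        nlinarith [mul_pos h2.2 this]
    rw [e1]; simp
  have h5 : ((starRingEnd ℂ) (b - a) * (d - a)).im = 0 := by
    have h6 : ((starRingEnd ℂ) (b - a) * (d - c)).im = 0 := by
      rw [im_conj_mul φ, h1.1, h2.1]; simp
    rw [show d - a = (d - c) + (c - a) by ring, mul_add, Complex.add_im, h3, h6, add_zero]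
  obtain ⟨s, hs⟩ := exists_real_mul_of_im_conj_mul_eq_zero (sub_ne_zero.2 hab.symm) h3
  obtain ⟨t, ht⟩ := exists_real_mul_of_im_conj_mul_eq_zero (sub_ne_zero.2 hab.symm) h5
  have h7 := h1.2
  have h8 := h2.2
  rcases eq_or_eq_of_collinear ha hb hc hab hs with rfl | rfl <;>
    rcases eq_or_eq_of_collinear ha hb hd hab ht with rfl | rfl
  · exact absurd rfl hcd
  · rfl
  · rw [tangentPart_sub] at h7 h8; linarith
  · exact absurd rfl hcd

theorem edges_finite {V : Finset ℂ}
    (hV : Set.extremePoints ℝ (convexHull ℝ (V : Set ℂ)) = V) :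
    (edges (convexHull ℝ (V : Set ℂ))).Finite := by
  refine (V ×ˢ V).finite_toSet.subset fun e he => ?_
  rw [Finset.mem_coe, Finset.mem_product, ← Finset.mem_coe, ← Finset.mem_coe, ← hV]
  exact ⟨he.1, he.2.1⟩

/-! ### The discrete Cauchy formula -/

theorem tangentPart_le_of_maximal {p q : ℂ} {s t : ℝ} (hst : s < t)
    (hp : ∀ φ ∈ Set.Icc s t, normalPart φ (q - p) ≤ 0) (hq : normalPart t (p - q) ≤ 0) :
    tangentPart t p ≤ tangentPart t q := by
  -- Turning back by `ε` compares the tied points by their tangential parts times `sin ε`; the cap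
  -- `1 < π` keeps `sin ε` positive.
  set ε := min (t - s) 1
  have hε : 0 < ε := lt_min (by linarith) one_pos
  have hε1 : ε ≤ 1 := min_le_right _ _
  have hε2 : ε ≤ t - s := min_le_left _ _
  have h0 := hp t ⟨hst.le, le_rfl⟩
  have h1 := hp (t - ε) ⟨by linarith, by linarith⟩
  have h2 : normalPart t (q - p) = 0 := by
    rw [normalPart_sub] at h0 hq ⊢; linarith
  rw [normalPart_eq_rotate _ t, h2, sub_sub_cancel, zero_mul, zero_sub, neg_nonpos,
    tangentPart_sub] at h1
  have hs := Real.sin_pos_of_pos_of_lt_pi hε (by linarith [Real.pi_gt_three])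
  have := nonneg_of_mul_nonneg_left h1 hs
  linarith

theorem le_tangentPart_of_maximal {p q : ℂ} {s t : ℝ} (hst : s < t)
    (hp : ∀ φ ∈ Set.Icc s t, normalPart φ (q - p) ≤ 0) (hq : normalPart s (p - q) ≤ 0) :
    tangentPart s q ≤ tangentPart s p := by
  set ε := min (t - s) 1
  have hε : 0 < ε := lt_min (by linarith) one_pos
  have hε1 : ε ≤ 1 := min_le_right _ _
  have hε2 : ε ≤ t - s := min_le_left _ _
  have h0 := hp s ⟨le_rfl, hst.le⟩
  have h1 := hp (s + ε) ⟨by linarith, by linarith⟩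
  have h2 : normalPart s (q - p) = 0 := by
    rw [normalPart_sub] at h0 hq ⊢; linarith
  rw [normalPart_eq_rotate _ s, h2, show s - (s + ε) = -ε by ring, zero_mul, zero_sub,
    Real.sin_neg, mul_neg, neg_neg, tangentPart_sub] at h1
  have hs := Real.sin_pos_of_pos_of_lt_pi hε (by linarith [Real.pi_gt_three])
  have : 0 ≤ -(tangentPart s q - tangentPart s p) :=
    nonneg_of_mul_nonneg_left (by linarith) hs
  linarith

/-- A discrete Cauchy formula: the perimeter is bounded by a sum over any cyclic subdivision of the
circle of directions that contains all edge normals. -/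
theorem perimeter_le_sum {V : Finset ℂ}
    (hV : Set.extremePoints ℝ (convexHull ℝ (V : Set ℂ)) = V) (hc : 2 ≤ V.card) {K : ℕ}
    (hK : 0 < K) {θ : ℕ → ℝ} (hθ : ∀ i < K, θ i < θ (i + 1)) (hper : θ K = θ 0 + 2 * Real.pi)
    (hno : ∀ i < K, ∀ φ ∈ Set.Ioo (θ i) (θ (i + 1)), ∀ e ∈ edges (convexHull ℝ (V : Set ℂ)),
      ¬ IsNormalAngle (e.2 - e.1) φ)
    (hall : ∀ e ∈ edges (convexHull ℝ (V : Set ℂ)), ∃ i < K, IsNormalAngle (e.2 - e.1) (θ i)) :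
    ∃ p : ℕ → ℂ, (∀ i < K, p i ∈ V) ∧ perimeter (convexHull ℝ (V : Set ℂ)) ≤
      ∑ i ∈ Finset.range K,
        2 * Real.sin ((θ (i + 1) - θ i) / 2) * normalPart ((θ i + θ (i + 1)) / 2) (p i) := by
  have hex := fun i (hi : i < K) => exists_common_maximizer hV hc (hθ i hi) (hno i hi)
  choose! p hpV hp using hex
  refine ⟨p, hpV, ?_⟩
  obtain ⟨k, rfl⟩ : ∃ k, K = k + 1 := ⟨K - 1, by omega⟩
  -- `q i` is the extremal vertex of the arc ending at `θ i`, cyclically; `p i` is that of the arc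
  -- starting there.
  let q : ℕ → ℂ := fun i => if i = 0 then p k else p (i - 1)
  have hq : ∀ i < k + 1, ∃ s < θ i, ∀ φ ∈ Set.Icc s (θ i), ∀ z ∈ V, normalPart φ (z - q i) ≤ 0 := by
    rintro (_ | i) hi
    · refine ⟨θ k - 2 * Real.pi, by linarith [hθ k (by omega)], fun φ hφ z hz => ?_⟩
      rw [← normalPart_add_two_pi]
      exact hp k (by omega) _ ⟨by linarith [hφ.1], by linarith [hφ.2]⟩ z hz
    · exact ⟨θ i, hθ i (by omega), hp i (by omega)⟩
  have hqV : ∀ i < k + 1, q i ∈ V := by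
    rintro (_ | i) hi
    · exact hpV k (by omega)
    · exact hpV i (by omega)
  -- Summation by parts: regroup the contributions by the angle `θ i` at which two arcs meet.
  have hsum : ∑ i ∈ Finset.range (k + 1),
        2 * Real.sin ((θ (i + 1) - θ i) / 2) * normalPart ((θ i + θ (i + 1)) / 2) (p i) =
      ∑ i ∈ Finset.range (k + 1), (tangentPart (θ i) (p i) - tangentPart (θ i) (q i)) := by
    simp_rw [two_sin_mul_normalPart, Finset.sum_sub_distrib]
    congr 1
    rw [Finset.sum_range_succ, Finset.sum_range_succ' (fun i => tangentPart (θ i) (q i)), hper,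
      tangentPart_add_two_pi]
    simp [q]
  -- Among the vertices extremal at `θ i`, `q i` is tangentially first and `p i` last, so any edge
  -- with this normal fits between them. The case `a = b` gives nonnegativity of the terms that have
  -- no edge.
  have hdiff : ∀ i < k + 1, ∀ a ∈ V, ∀ b ∈ V, (∀ z ∈ V, normalPart (θ i) (z - a) ≤ 0) →
      (∀ z ∈ V, normalPart (θ i) (z - b) ≤ 0) →
      tangentPart (θ i) (b - a) ≤ tangentPart (θ i) (p i) - tangentPart (θ i) (q i) := by
    intro i hi a ha b hb hamax hbmax
    obtain ⟨s, hs, hqs⟩ := hq i hi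
    have h1 := tangentPart_le_of_maximal hs (fun φ hφ => hqs φ hφ a ha) (hamax _ (hqV i hi))
    have h2 := le_tangentPart_of_maximal (hθ i hi) (fun φ hφ => hp i hi φ hφ b hb)
      (hbmax _ (hpV i hi))
    rw [tangentPart_sub]
    linarith
  rw [hsum, perimeter, finsum_mem_eq_finite_toFinset_sum _ (edges_finite hV)]
  choose! ι hι hιn using hall
  have hmem : ∀ {e}, e ∈ (edges_finite hV).toFinset ↔ e ∈ edges (convexHull ℝ (V : Set ℂ)) :=
    (edges_finite hV).mem_toFinset
  have hinj : Set.InjOn ι ((edges_finite hV).toFinset : Set (ℂ × ℂ)) := by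
    intro e he f hf hef
    rw [Finset.mem_coe, hmem] at he hf
    exact edges_eq_of_isNormalAngle he hf (hιn e he) (hef ▸ hιn f hf)
  calc ∑ e ∈ (edges_finite hV).toFinset, ‖e.2 - e.1‖
      ≤ ∑ e ∈ (edges_finite hV).toFinset,
          (tangentPart (θ (ι e)) (p (ι e)) - tangentPart (θ (ι e)) (q (ι e))) := by
        refine Finset.sum_le_sum fun e he => ?_
        rw [hmem] at he
        have hn := hιn e he
        obtain ⟨h1, h2, h3⟩ := (mem_edges_iff (a := e.1) (b := e.2) hV hn).1 he
        rw [norm_eq_tangentPart hn.1 hn.2]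
        refine hdiff _ (hι e he) _ h1 _ h2 h3 fun z hz => ?_
        have h4 := h3 z hz
        have h5 := hn.1
        rw [normalPart_sub] at h4 h5 ⊢
        linarith
    _ = ∑ i ∈ (edges_finite hV).toFinset.image ι,
          (tangentPart (θ i) (p i) - tangentPart (θ i) (q i)) := by
        rw [Finset.sum_image hinj]
    _ ≤ _ := by
        refine Finset.sum_le_sum_of_subset_of_nonneg ?_ ?_
        · intro i hi
          obtain ⟨e, he, rfl⟩ := Finset.mem_image.1 hi
          exact Finset.mem_range.2 (hι e (hmem.1 he))
        · intro i hi _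
          rw [Finset.mem_range] at hi
          have hpm := hp i hi (θ i) ⟨le_rfl, (hθ i hi).le⟩
          have := hdiff i hi _ (hpV i hi) _ (hpV i hi) hpm hpm
          rwa [sub_self, tangentPart, Complex.zero_im, Complex.zero_re, zero_mul, zero_mul,
            sub_zero] at this

/-! ### Cyclic order of the normal angles -/

/-- Cyclic enumeration of a periodic set of angles. -/
theorem exists_cyclic_enumeration {A : Set ℝ} {F : Finset ℝ} (hF : F.Nonempty)
    (hA : ∀ x, x ∈ A → x - 2 * Real.pi ∈ A)
    (hFA : ∀ x, x ∈ F ↔ x ∈ A ∧ x ∈ Set.Ico 0 (2 * Real.pi)) :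
    ∃ θ : ℕ → ℝ, (∀ i < F.card, θ i < θ (i + 1)) ∧ θ F.card = θ 0 + 2 * Real.pi ∧
      (∀ i < F.card, ∀ φ ∈ Set.Ioo (θ i) (θ (i + 1)), φ ∉ A) ∧ ∀ x ∈ F, ∃ i < F.card, θ i = x := by
  have hK : 0 < F.card := Finset.card_pos.2 hF
  let o := F.orderEmbOfFin rfl
  have ho : ∀ i, o i ∈ F := F.orderEmbOfFin_mem rfl
  have hsurj : ∀ x ∈ F, ∃ i, o i = x := fun x hx => by
    have : x ∈ Set.range (F.orderEmbOfFin rfl) := by rw [F.range_orderEmbOfFin rfl]; exact hx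
    exact this
  let θ : ℕ → ℝ := fun i => if h : i < F.card then o ⟨i, h⟩ else o ⟨0, hK⟩ + 2 * Real.pi
  have hθ : ∀ i (h : i < F.card), θ i = o ⟨i, h⟩ := fun i h => dif_pos h
  have hθ' : θ F.card = o ⟨0, hK⟩ + 2 * Real.pi := dif_neg (lt_irrefl _)
  have hlast : ∀ i < F.card, ¬ i + 1 < F.card → i + 1 = F.card := fun i h h' => by omega
  refine ⟨θ, fun i hi => ?_, ?_, fun i hi φ hφ hmem => ?_, fun x hx => ?_⟩
  · by_cases h : i + 1 < F.card
    · rw [hθ i hi, hθ _ h]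
      exact o.strictMono (Fin.mk_lt_mk.2 (Nat.lt_succ_self i))
    · rw [hlast i hi h, hθ', hθ i hi]
      linarith [((hFA _).1 (ho ⟨i, hi⟩)).2.2, ((hFA _).1 (ho ⟨0, hK⟩)).2.1]
  · rw [hθ', hθ 0 hK]
  · have hi0 := ((hFA _).1 (ho ⟨i, hi⟩)).2
    have hnot : ¬ φ ∈ F ∨ i + 1 = F.card := by
      by_cases h : i + 1 < F.card
      · left
        intro hm
        obtain ⟨j, rfl⟩ := hsurj φ hm
        rw [hθ i hi, hθ _ h] at hφ
        have h1 := Fin.lt_def.1 (o.lt_iff_lt.1 hφ.1)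
        have h2 := Fin.lt_def.1 (o.lt_iff_lt.1 hφ.2)
        simp only at h1 h2
        omega
      · exact Or.inr (hlast i hi h)
    by_cases h2π : φ < 2 * Real.pi
    · have hm : φ ∈ F := (hFA φ).2 ⟨hmem, by rw [hθ i hi] at hφ; linarith [hφ.1, hi0.1], h2π⟩
      have hl := hnot.resolve_left (not_not.2 hm)
      obtain ⟨j, rfl⟩ := hsurj φ hm
      rw [hθ i hi] at hφ
      have h1 := Fin.lt_def.1 (o.lt_iff_lt.1 hφ.1)
      simp only at h1
      omega
    -- An angle past `2π` can only occur in the wrap-around arc; shifted back by `2π` it would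
    -- precede the least element of `F`.
    · have hl : i + 1 = F.card := by
        by_contra hne
        have h : i + 1 < F.card := by omega
        rw [hθ _ h] at hφ
        linarith [hφ.2, ((hFA _).1 (ho ⟨i + 1, h⟩)).2.2]
      rw [hl, hθ'] at hφ
      have h0 := ((hFA _).1 (ho ⟨0, hK⟩)).2.2
      have hm : φ - 2 * Real.pi ∈ F :=
        (hFA _).2 ⟨hA φ hmem, by linarith, by linarith [hφ.2]⟩
      obtain ⟨j, hj⟩ := hsurj _ hm
      have hle : o ⟨0, hK⟩ ≤ o j := o.monotone (Fin.mk_le_mk.2 (Nat.zero_le _))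
      linarith [hφ.2]
  · obtain ⟨j, rfl⟩ := hsurj x hx
    exact ⟨j, j.2, hθ _ _⟩

theorem isNormalAngle_arg {v : ℂ} (hv : v ≠ 0) : IsNormalAngle v (v.arg - Real.pi / 2) := by
  have hn : 0 < ‖v‖ := norm_pos_iff.2 hv
  have h1 : v.re = ‖v‖ * Real.cos v.arg := (Complex.norm_mul_cos_arg v).symm
  have h2 : v.im = ‖v‖ * Real.sin v.arg := (Complex.norm_mul_sin_arg v).symm
  have h3 := Real.sin_sq_add_cos_sq v.arg
  constructor
  · rw [normalPart, Real.cos_sub_pi_div_two, Real.sin_sub_pi_div_two, h1, h2]; ring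
  · rw [tangentPart, Real.cos_sub_pi_div_two, Real.sin_sub_pi_div_two, h1, h2]
    calc 0 < ‖v‖ := hn
      _ = _ := by linear_combination -‖v‖ * h3

theorem IsNormalAngle.add_int_mul {v : ℂ} {φ : ℝ} (h : IsNormalAngle v φ) (k : ℤ) :
    IsNormalAngle v (φ + k * (2 * Real.pi)) := by
  simpa only [IsNormalAngle, normalPart, tangentPart, Real.cos_add_int_mul_two_pi,
    Real.sin_add_int_mul_two_pi] using h

theorem IsNormalAngle.eq_of_abs_sub_lt {v : ℂ} {φ ψ : ℝ} (h : IsNormalAngle v φ)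
    (h' : IsNormalAngle v ψ) (hlt : |ψ - φ| < 2 * Real.pi) : φ = ψ := by
  have h1 := normalPart_eq_rotate φ ψ v
  have h2 := tangentPart_eq_rotate φ ψ v
  rw [h.1, h'.1, zero_mul, zero_sub, eq_comm, neg_eq_zero,
    mul_eq_zero_iff_left h'.2.ne'] at h1
  rw [h'.1, zero_mul, add_zero] at h2
  have hc : 0 < Real.cos (ψ - φ) := by
    by_contra! hh
    nlinarith [h.2, h'.2]
  have hcos : Real.cos (ψ - φ) = 1 := by nlinarith [Real.sin_sq_add_cos_sq (ψ - φ)]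
  have := (Real.cos_eq_one_iff_of_lt_of_lt (abs_lt.1 hlt).1 (abs_lt.1 hlt).2).1 hcos
  linarith

theorem card_edges_le {V : Finset ℂ}
    (hV : Set.extremePoints ℝ (convexHull ℝ (V : Set ℂ)) = V) :
    (edges_finite hV).toFinset.card ≤ V.card := by
  refine Finset.card_le_card_of_injOn Prod.fst (fun e he => ?_) ?_
  · rw [Set.Finite.coe_toFinset] at he
    rw [← hV]
    exact he.1
  · rw [Set.Finite.coe_toFinset]
    exact edges_fst_injOn _

theorem edges_nonempty {V : Finset ℂ}
    (hV : Set.extremePoints ℝ (convexHull ℝ (V : Set ℂ)) = V) (hc : 2 ≤ V.card) :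
    (edges (convexHull ℝ (V : Set ℂ))).Nonempty := by
  obtain ⟨p, hp, hmax⟩ := Finset.exists_max_image V (normalPart 0) (Finset.card_pos.1 (by omega))
  obtain ⟨b, _, hb, -⟩ := exists_edge_after (m := 0) hV hc hp fun z hz => by
    rw [normalPart_sub]; linarith [hmax z hz]
  exact ⟨_, hb⟩

theorem perimeter_pos {V : Finset ℂ}
    (hV : Set.extremePoints ℝ (convexHull ℝ (V : Set ℂ)) = V) (hc : 2 ≤ V.card) :
    0 < perimeter (convexHull ℝ (V : Set ℂ)) := by
  obtain ⟨e, he⟩ := edges_nonempty hV hc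
  rw [perimeter, finsum_mem_eq_finite_toFinset_sum _ (edges_finite hV)]
  exact Finset.sum_pos' (fun _ _ => norm_nonneg _)
    ⟨e, (edges_finite hV).mem_toFinset.2 he, norm_pos_iff.2 (sub_ne_zero.2 he.2.2.1.symm)⟩

theorem perimeter_eq_zero_of_card_le_one {V : Finset ℂ}
    (hV : Set.extremePoints ℝ (convexHull ℝ (V : Set ℂ)) = V) (hc : V.card ≤ 1) :
    perimeter (convexHull ℝ (V : Set ℂ)) = 0 := by
  have : edges (convexHull ℝ (V : Set ℂ)) = ∅ := by
    refine Set.eq_empty_of_forall_notMem fun e he => he.2.2.1 ?_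
    have h1 := he.1
    have h2 := he.2.1
    rw [hV] at h1 h2
    exact Finset.card_le_one.1 hc _ h1 _ h2
  rw [perimeter, this, finsum_mem_empty]

/-! ### The lower bound for the gain -/

theorem normalPart_mul (θ : ℝ) (h z : ℂ) :
    normalPart θ (z * h) = ‖h‖ * normalPart (θ - h.arg) z := by
  have h1 : h.re = ‖h‖ * Real.cos h.arg := (Complex.norm_mul_cos_arg h).symm
  have h2 : h.im = ‖h‖ * Real.sin h.arg := (Complex.norm_mul_sin_arg h).symm
  rw [normalPart, normalPart, Complex.mul_re, Complex.mul_im, h1, h2, Real.cos_sub, Real.sin_sub]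
  ring

theorem normalPart_sum {ι : Type*} (s : Finset ι) (θ : ℝ) (f : ι → ℂ) :
    normalPart θ (∑ i ∈ s, f i) = ∑ i ∈ s, normalPart θ (f i) := by
  simp only [normalPart, Complex.re_sum, Complex.im_sum, Finset.sum_mul, Finset.sum_add_distrib]

/-- Jensen's inequality for sine on `[0, π]`: the half-gaps sum to `π`, and padding with zeros up to
`L` terms leaves both the angle sum and the sine sum unchanged. -/
theorem sum_sin_half_le {K L : ℕ} (hK : 0 < K) (hKL : K ≤ L) {θ : ℕ → ℝ}
    (hθ : ∀ i < K, θ i < θ (i + 1)) (hper : θ K = θ 0 + 2 * Real.pi) :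
    ∑ i ∈ Finset.range K, Real.sin ((θ (i + 1) - θ i) / 2) ≤ L * Real.sin (Real.pi / L) := by
  have hL : (0 : ℝ) < L := by exact_mod_cast (by omega : 0 < L)
  let α : ℕ → ℝ := fun i => if i < K then (θ (i + 1) - θ i) / 2 else 0
  have hα0 : ∀ i, 0 ≤ α i := fun i => by
    simp only [α]
    split_ifs with h
    · linarith [hθ i h]
    · rfl
  have hext : ∀ f : ℝ → ℝ, f 0 = 0 → ∑ i ∈ Finset.range K, f ((θ (i + 1) - θ i) / 2) =
      ∑ i ∈ Finset.range L, f (α i) := by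
    intro f hf
    rw [← Finset.sum_subset (Finset.range_subset_range.2 hKL)]
    · refine Finset.sum_congr rfl fun i hi => ?_
      simp only [α, if_pos (Finset.mem_range.1 hi)]
    · intro i _ hi
      simp only [α, if_neg (fun h => hi (Finset.mem_range.2 h)), hf]
  have htot : ∑ i ∈ Finset.range L, α i = Real.pi := by
    have h1 := hext id rfl
    simp only [id] at h1
    rw [← h1, ← Finset.sum_div, Finset.sum_range_sub, hper]
    ring
  have hαπ : ∀ i ∈ Finset.range L, α i ∈ Set.Icc 0 Real.pi := fun i hi =>
    ⟨hα0 i, htot ▸ Finset.single_le_sum (fun j _ => hα0 j) hi⟩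
  have hJ := strictConcaveOn_sin_Icc.concaveOn.le_map_sum (t := Finset.range L)
    (w := fun _ => 1 / (L : ℝ)) (p := α) (fun _ _ => by positivity)
    (by rw [Finset.sum_const, Finset.card_range, nsmul_eq_mul]; field_simp) hαπ
  simp only [smul_eq_mul, ← Finset.mul_sum, htot] at hJ
  rw [hext Real.sin Real.sin_zero]
  rw [one_div_mul_eq_div, one_div_mul_eq_div, div_le_iff₀ hL] at hJ
  linarith

theorem normalPart_le_gain {N : ℕ} {W : Set ℂ} (hW : IsCompact W) {w : Fin N → ℂ}
    (hw : ∀ n, w n ∈ W) (h : Fin N → ℂ) (θ : ℝ) :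
    normalPart θ (∑ n, w n * h n) ≤ gain W h := by
  refine (normalPart_le_norm _ _).trans ?_
  rcases W.eq_empty_or_nonempty with rfl | hne
  · rcases isEmpty_or_nonempty (Fin N) with hN | ⟨⟨n⟩⟩
    · have : gainValues (∅ : Set ℂ) h = {0} := by
        ext x
        simp [gainValues]
      rw [gain, this]
      simp
    · exact absurd (hw n) (Set.notMem_empty _)
  · exact (isGreatest_gain hW hne h).2 ⟨w, hw, rfl⟩

theorem perimeter_mul_idealGain_le {M N : ℕ} (hMN : 2 ≤ M * N) {W : Set ℂ} (hW : IsCompact W)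
    (hP : IsPolygon (convexHull ℝ W) M) (h : Fin N → ℂ) :
    perimeter (convexHull ℝ W) * idealGain h ≤
      2 * (M * N) * Real.sin (Real.pi / (M * N)) * gain W h := by
  obtain ⟨V, hcard, hVW, hV⟩ := hP
  have hsub : ∀ v ∈ V, v ∈ W := fun v hv => by
    have : v ∈ Set.extremePoints ℝ (convexHull ℝ W) := by rw [hV]; exact hv
    exact extremePoints_convexHull_subset this
  have hN : 0 < N := Nat.pos_of_ne_zero (by rintro rfl; simp at hMN)
  have hM : 0 < M := Nat.pos_of_ne_zero (by rintro rfl; simp at hMN)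
  obtain ⟨v, hv⟩ : V.Nonempty := Finset.card_pos.1 (by omega)
  have hg : 0 ≤ gain W h := by
    have := (isGreatest_gain hW ⟨v, hsub v hv⟩ h).1
    obtain ⟨w, -, hw⟩ := this
    rw [← hw]
    exact norm_nonneg _
  rw [hVW] at hV ⊢
  have hMNr : (2 : ℝ) ≤ M * N := by exact_mod_cast hMN
  have hsin : 0 ≤ Real.sin (Real.pi / (M * N)) := by
    refine Real.sin_nonneg_of_nonneg_of_le_pi (by positivity) (div_le_self Real.pi_pos.le ?_)
    linarith
  by_cases hM1 : M = 1
  · rw [perimeter_eq_zero_of_card_le_one hV (by omega), zero_mul]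
    positivity
  have hc : 2 ≤ V.card := by omega
  set P := convexHull ℝ (V : Set ℂ)
  have hEf := edges_finite hV
  -- All edge normals of the copies of `P` rotated by `arg (h n)`; `F` is the set of their
  -- representatives in `[0, 2π)`.
  let A : Set ℝ := {x | ∃ n, ∃ e ∈ edges P, IsNormalAngle (e.2 - e.1) (x - (h n).arg)}
  let g : (ℂ × ℂ) × Fin N → ℝ := fun x =>
    toIcoMod Real.two_pi_pos 0 ((x.1.2 - x.1.1).arg - Real.pi / 2 + (h x.2).arg)
  let F : Finset ℝ := (hEf.toFinset ×ˢ Finset.univ).image g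
  have hgA : ∀ e ∈ edges P, ∀ n,
      IsNormalAngle (e.2 - e.1) (g (e, n) - (h n).arg) ∧ g (e, n) ∈ Set.Ico 0 (2 * Real.pi) := by
    intro e he n
    have h1 := toIcoMod_mem_Ico' Real.two_pi_pos
      ((e.2 - e.1).arg - Real.pi / 2 + (h n).arg)
    refine ⟨?_, h1⟩
    have h2 := (isNormalAngle_arg (sub_ne_zero.2 he.2.2.1.symm)).add_int_mul
      (-toIcoDiv Real.two_pi_pos 0 ((e.2 - e.1).arg - Real.pi / 2 + (h n).arg))
    convert h2 using 1
    simp only [g, toIcoMod, zsmul_eq_mul]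
    push_cast
    ring
  have hFA : ∀ x, x ∈ F ↔ x ∈ A ∧ x ∈ Set.Ico 0 (2 * Real.pi) := by
    intro x
    constructor
    · intro hx
      obtain ⟨⟨e, n⟩, hen, rfl⟩ := Finset.mem_image.1 hx
      have he : e ∈ edges P := hEf.mem_toFinset.1 (Finset.mem_product.1 hen).1
      exact ⟨⟨n, e, he, (hgA e he n).1⟩, (hgA e he n).2⟩
    · rintro ⟨⟨n, e, he, hx⟩, hI⟩
      refine Finset.mem_image.2 ⟨(e, n), Finset.mem_product.2
        ⟨hEf.mem_toFinset.2 he, Finset.mem_univ _⟩, ?_⟩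
      have h1 := hgA e he n
      have := h1.1.eq_of_abs_sub_lt hx (by
        rw [abs_lt]; constructor <;> linarith [h1.2.1, h1.2.2, hI.1, hI.2])
      linarith
  have hA : ∀ x, x ∈ A → x - 2 * Real.pi ∈ A := by
    rintro x ⟨n, e, he, hx⟩
    refine ⟨n, e, he, ?_⟩
    have := hx.add_int_mul (-1)
    convert this using 1
    push_cast
    ring
  have hFne : F.Nonempty := by
    obtain ⟨e, he⟩ := edges_nonempty hV hc
    exact ⟨_, Finset.mem_image_of_mem g (a := (e, ⟨0, hN⟩))
      (Finset.mem_product.2 ⟨hEf.mem_toFinset.2 he, Finset.mem_univ _⟩)⟩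
  have hFcard : F.card ≤ M * N := by
    refine Finset.card_image_le.trans ?_
    rw [Finset.card_product, Finset.card_univ, Fintype.card_fin]
    exact Nat.mul_le_mul_right _ (hcard ▸ card_edges_le hV)
  obtain ⟨θ, hθ, hper, hno, hall⟩ := exists_cyclic_enumeration hFne hA hFA
  have hK : 0 < F.card := Finset.card_pos.2 hFne
  have key : ∀ n, ∃ p : ℕ → ℂ, (∀ i < F.card, p i ∈ V) ∧ perimeter P ≤
      ∑ i ∈ Finset.range F.card, 2 * Real.sin ((θ (i + 1) - θ i) / 2) *
        normalPart ((θ i + θ (i + 1)) / 2 - (h n).arg) (p i) := by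
    intro n
    -- Shifted by `-arg (h n)`, the common subdivision contains every edge normal of `P` itself.
    obtain ⟨p, hpV, hp⟩ := perimeter_le_sum hV hc hK (θ := fun i => θ i - (h n).arg)
      (fun i hi => by linarith [hθ i hi]) (by rw [hper]; ring)
      (fun i hi φ hφ e he hn => hno i hi (φ + (h n).arg) ⟨by linarith [hφ.1], by linarith [hφ.2]⟩
        ⟨n, e, he, by rwa [add_sub_cancel_right]⟩)
      (fun e he => by
        obtain ⟨i, hi, hie⟩ := hall (g (e, n)) (Finset.mem_image_of_mem g (Finset.mem_product.2
          ⟨hEf.mem_toFinset.2 he, Finset.mem_univ _⟩))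
        exact ⟨i, hi, by rw [hie]; exact (hgA e he n).1⟩)
    refine ⟨p, hpV, hp.trans_eq (Finset.sum_congr rfl fun i _ => ?_)⟩
    rw [sub_sub_sub_cancel_right, show (θ i - (h n).arg + (θ (i + 1) - (h n).arg)) / 2 =
      (θ i + θ (i + 1)) / 2 - (h n).arg by ring]
  choose p hpV hp using key
  calc perimeter P * idealGain h = ∑ n, ‖h n‖ * perimeter P := by
        rw [idealGain, mul_comm, Finset.sum_mul]
    _ ≤ ∑ n, ‖h n‖ * ∑ i ∈ Finset.range F.card, 2 * Real.sin ((θ (i + 1) - θ i) / 2) *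
        normalPart ((θ i + θ (i + 1)) / 2 - (h n).arg) (p n i) :=
        Finset.sum_le_sum fun n _ => mul_le_mul_of_nonneg_left (hp n) (norm_nonneg _)
    _ = ∑ i ∈ Finset.range F.card, 2 * Real.sin ((θ (i + 1) - θ i) / 2) *
        normalPart ((θ i + θ (i + 1)) / 2) (∑ n, p n i * h n) := by
        simp_rw [normalPart_sum, normalPart_mul, Finset.mul_sum]
        rw [Finset.sum_comm]
        exact Finset.sum_congr rfl fun i _ => Finset.sum_congr rfl fun n _ => by ring
    _ ≤ ∑ i ∈ Finset.range F.card, 2 * Real.sin ((θ (i + 1) - θ i) / 2) * gain W h := by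
        -- For fixed `i`, the vertices `p n i` are an admissible choice of `w`.
        refine Finset.sum_le_sum fun i hi => ?_
        rw [Finset.mem_range] at hi
        have hgap : θ (i + 1) - θ i ≤ 2 * Real.pi := by
          have h1 := Finset.single_le_sum (f := fun i => θ (i + 1) - θ i)
            (fun j hj => (sub_nonneg.2 (hθ j (Finset.mem_range.1 hj)).le)) (Finset.mem_range.2 hi)
          rw [Finset.sum_range_sub, hper] at h1
          linarith
        refine mul_le_mul_of_nonneg_left
          (normalPart_le_gain hW (fun n => hsub _ (hpV n i hi)) h _)
          (mul_nonneg two_pos.le (Real.sin_nonneg_of_nonneg_of_le_pi ?_ (by linarith)))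
        linarith [hθ i hi]
    _ = 2 * (∑ i ∈ Finset.range F.card, Real.sin ((θ (i + 1) - θ i) / 2)) * gain W h := by
        rw [Finset.mul_sum, Finset.sum_mul]
    _ ≤ 2 * ((M * N : ℕ) * Real.sin (Real.pi / (M * N : ℕ))) * gain W h := by
        gcongr
        exact sum_sin_half_le hK hFcard hθ hper
    _ = _ := by push_cast; ring

/-! ### Regular polygons and their perimeters -/

/-- The vertices of the regular `M`-gon, indexed by all integers. -/
noncomputable def gonVertex (M : ℕ) (k : ℤ) : ℂ :=
  Complex.exp ((2 * Real.pi * k / M : ℝ) * Complex.I)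

theorem norm_gonVertex (M : ℕ) (k : ℤ) : ‖gonVertex M k‖ = 1 :=
  Complex.norm_exp_ofReal_mul_I _

theorem gonVertex_add (M : ℕ) (j k : ℤ) :
    gonVertex M (j + k) = gonVertex M j * gonVertex M k := by
  rw [gonVertex, gonVertex, gonVertex, ← Complex.exp_add]
  congr 1
  push_cast
  ring

theorem gonVertex_eq_iff {M : ℕ} (hM : 0 < M) {j k : ℤ} :
    gonVertex M j = gonVertex M k ↔ (M : ℤ) ∣ j - k := by
  have hM' : (M : ℂ) ≠ 0 := by exact_mod_cast hM.ne'
  have hπ : (2 * Real.pi * Complex.I : ℂ) ≠ 0 := Complex.two_pi_I_ne_zero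
  rw [gonVertex, gonVertex, Complex.exp_eq_exp_iff_exists_int]
  refine exists_congr fun n => ?_
  have e1 : ((2 * Real.pi * j / M : ℝ) * Complex.I : ℂ) =
      (2 * Real.pi * Complex.I) * (j / M) := by push_cast; ring
  have e2 : ((2 * Real.pi * k / M : ℝ) * Complex.I + n * (2 * Real.pi * Complex.I) : ℂ) =
      (2 * Real.pi * Complex.I) * (k / M + n) := by push_cast; ring
  rw [e1, e2, mul_right_inj' hπ, div_add' _ _ _ hM', div_left_inj' hM', ← Int.cast_inj (α := ℂ)]
  push_cast
  constructor
  · intro h; linear_combination h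
  · intro h; linear_combination h

theorem exists_fin_gonVertex_eq {M : ℕ} (hM : 0 < M) (k : ℤ) :
    ∃ i : Fin M, gonVertex M i = gonVertex M k := by
  have hM' : (0 : ℤ) < M := by exact_mod_cast hM
  have h0 := Int.emod_nonneg k hM'.ne'
  have h1 := Int.emod_lt_of_pos k hM'
  refine ⟨⟨(k % M).toNat, by omega⟩, (gonVertex_eq_iff hM).2 ?_⟩
  rw [Int.toNat_of_nonneg h0]
  exact (Int.mod_modEq k M).symm.dvd

theorem gonVertex_fin_injective {M : ℕ} (hM : 0 < M) :
    Function.Injective fun i : Fin M => gonVertex M i := by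
  intro i j hij
  obtain ⟨c, hc⟩ := (gonVertex_eq_iff hM).1 hij
  have hi := i.2
  have hj := j.2
  have : c = 0 := by
    by_contra h
    rcases lt_or_gt_of_ne h with h | h
    · nlinarith [show (1 : ℤ) ≤ M by omega, show c ≤ -1 by omega]
    · nlinarith [show (1 : ℤ) ≤ M by omega, show 1 ≤ c by omega]
  rw [this] at hc
  exact Fin.ext (by omega)

theorem regularGon_eq_range_fin (M : ℕ) :
    regularGon M = Set.range fun i : Fin M => gonVertex M i := by
  refine congrArg Set.range (funext fun i => ?_)
  rw [gonVertex]
  congr 1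
  push_cast
  ring

theorem mem_regularGon {M : ℕ} (hM : 0 < M) {z : ℂ} :
    z ∈ regularGon M ↔ ∃ k, gonVertex M k = z := by
  rw [regularGon_eq_range_fin]
  constructor
  · rintro ⟨i, rfl⟩
    exact ⟨_, rfl⟩
  · rintro ⟨k, rfl⟩
    exact exists_fin_gonVertex_eq hM k

theorem isCompact_regularGon (M : ℕ) : IsCompact (regularGon M) :=
  (Set.finite_range _).isCompact

theorem regularGon_subset_sphere (M : ℕ) : regularGon M ⊆ Metric.sphere 0 1 := by
  rw [regularGon_eq_range_fin]
  rintro _ ⟨i, rfl⟩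
  simpa using norm_gonVertex M i

/-- The hull lies in the closed unit ball, whose strict convexity puts proper open segments in its
interior, off the sphere. -/
theorem extremePoints_convexHull_of_subset_sphere {S : Set ℂ} (hS : S ⊆ Metric.sphere 0 1) :
    Set.extremePoints ℝ (convexHull ℝ S) = S := by
  refine Set.Subset.antisymm extremePoints_convexHull_subset fun z hz => ?_
  have hball : convexHull ℝ S ⊆ Metric.closedBall 0 1 :=
    convexHull_min (hS.trans Metric.sphere_subset_closedBall) (convex_closedBall _ _)
  refine mem_extremePoints.2 ⟨subset_convexHull ℝ _ hz, fun x hx y hy hxy => ?_⟩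
  by_cases h : x = y
  · subst h
    rw [openSegment_same] at hxy
    exact ⟨hxy.symm, hxy.symm⟩
  · have h1 := (strictConvex_closedBall ℝ (0 : ℂ) 1).openSegment_subset (hball hx) (hball hy) h hxy
    rw [interior_closedBall _ one_ne_zero, mem_ball_zero_iff] at h1
    have h2 := mem_sphere_zero_iff_norm.1 (hS hz)
    linarith

theorem exists_finset_regularGon {M : ℕ} (hM : 0 < M) :
    ∃ V : Finset ℂ, V.card = M ∧ (V : Set ℂ) = regularGon M := by
  classical
  refine ⟨Finset.univ.image fun i : Fin M => gonVertex M i, ?_, ?_⟩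
  · rw [Finset.card_image_of_injective _ (gonVertex_fin_injective hM), Finset.card_univ,
      Fintype.card_fin]
  · rw [Finset.coe_image, Finset.coe_univ, Set.image_univ, regularGon_eq_range_fin]

theorem isPolygon_regularGon {M : ℕ} (hM : 0 < M) :
    IsPolygon (convexHull ℝ (regularGon M)) M := by
  obtain ⟨V, hc, hV⟩ := exists_finset_regularGon hM
  refine ⟨V, hc, by rw [hV], ?_⟩
  rw [hV]
  exact extremePoints_convexHull_of_subset_sphere (regularGon_subset_sphere M)

theorem im_conj_exp_sub_mul_exp_sub (a b c : ℝ) :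
    ((starRingEnd ℂ) (Complex.exp (b * Complex.I) - Complex.exp (a * Complex.I)) *
      (Complex.exp (c * Complex.I) - Complex.exp (a * Complex.I))).im =
      4 * Real.sin ((b - a) / 2) * Real.sin ((c - a) / 2) * Real.sin ((c - b) / 2) := by
  simp only [Complex.mul_im, Complex.conj_re, Complex.conj_im, Complex.sub_re, Complex.sub_im,
    Complex.exp_ofReal_mul_I_re, Complex.exp_ofReal_mul_I_im]
  rw [Real.cos_sub_cos b a, Real.sin_sub_sin c a, Real.sin_sub_sin b a, Real.cos_sub_cos c a,
    show (c - b) / 2 = (c + a) / 2 - (b + a) / 2 by ring, Real.sin_sub ((c + a) / 2)]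
  ring

theorem im_conj_gonVertex_sub_mul (M : ℕ) (i j k : ℤ) :
    ((starRingEnd ℂ) (gonVertex M j - gonVertex M i) * (gonVertex M k - gonVertex M i)).im =
      4 * Real.sin (Real.pi * (j - i : ℤ) / M) * Real.sin (Real.pi * (k - i : ℤ) / M) *
        Real.sin (Real.pi * (k - j : ℤ) / M) := by
  rw [gonVertex, gonVertex, gonVertex, im_conj_exp_sub_mul_exp_sub]
  push_cast
  ring_nf

theorem sin_pi_mul_div_nonneg {M : ℕ} {k : ℤ} (h0 : 0 ≤ k) (h1 : k ≤ M) :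
    0 ≤ Real.sin (Real.pi * k / M) := by
  have h0' : (0 : ℝ) ≤ k := by exact_mod_cast h0
  have h1' : (k : ℝ) ≤ M := by exact_mod_cast h1
  refine Real.sin_nonneg_of_nonneg_of_le_pi (by positivity) (div_le_of_le_mul₀ (by positivity)
    Real.pi_pos.le (by gcongr))

theorem sin_pi_mul_div_pos {M : ℕ} {k : ℤ} (h0 : 0 < k) (h1 : k < M) :
    0 < Real.sin (Real.pi * k / M) := by
  have h0' : (0 : ℝ) < k := by exact_mod_cast h0
  have h1' : (k : ℝ) < M := by exact_mod_cast h1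
  have : (0 : ℝ) < M := h0'.trans h1'
  refine Real.sin_pos_of_pos_of_lt_pi (by positivity) ?_
  rw [div_lt_iff₀ this]
  gcongr

/-- The orientation of three vertices is a product of three sines. If the second endpoint were `d >
1` steps ahead, vertex `i + 1` would lie strictly to the right. -/
theorem edges_regularGon {M : ℕ} (hM : 2 ≤ M) :
    edges (convexHull ℝ (regularGon M)) =
      Set.range fun i : Fin M => (gonVertex M i, gonVertex M (i + 1)) := by
  have hM0 : 0 < M := by omega
  have hM' : (0 : ℤ) < M := by exact_mod_cast hM0
  have hper : ∀ j k : ℤ, gonVertex M (j + (k - j) % M) = gonVertex M k := fun j k => by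
    rw [gonVertex_eq_iff hM0]
    have := (Int.mod_modEq (k - j) M).symm.dvd
    convert this using 1
    ring
  ext ⟨a, b⟩
  simp only [edges, Set.mem_ofPred_eq, Set.mem_range, Prod.mk.injEq,
    extremePoints_convexHull_of_subset_sphere (regularGon_subset_sphere M)]
  constructor
  · rintro ⟨ha, hb, hab, hle⟩
    rw [mem_regularGon hM0] at hb
    rw [regularGon_eq_range_fin] at ha
    obtain ⟨i, rfl⟩ := ha
    obtain ⟨k, rfl⟩ := hb
    refine ⟨i, rfl, ?_⟩
    rw [← hper i k] at hab hle ⊢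
    have h0 := Int.emod_nonneg (k - i) hM'.ne'
    have h1 := Int.emod_lt_of_pos (k - i) hM'
    generalize (k - i) % (M : ℤ) = d at *
    have hd : d ≠ 0 := by
      rintro rfl
      simp at hab
    by_contra hne
    have hd1 : d ≠ 1 := by
      rintro rfl
      exact hne rfl
    have h2 := hle (gonVertex M (i + 1))
      (subset_convexHull ℝ _ ((mem_regularGon hM0).2 ⟨_, rfl⟩))
    rw [im_conj_gonVertex_sub_mul, show (i : ℤ) + d - i = d by ring,
      show (i : ℤ) + 1 - i = 1 by ring, show (i : ℤ) + 1 - (i + d) = -(d - 1) by ring,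
      Int.cast_neg, mul_neg, neg_div, Real.sin_neg, mul_neg, neg_nonneg] at h2
    have h3 := sin_pi_mul_div_pos (M := M) (k := d) (by omega) (by omega)
    have h4 := sin_pi_mul_div_pos (M := M) (k := 1) (by omega) (by omega)
    have h5 := sin_pi_mul_div_pos (M := M) (k := d - 1) (by omega) (by omega)
    have := mul_pos (mul_pos (mul_pos four_pos h3) h4) h5
    linarith
  · rintro ⟨i, rfl, rfl⟩
    have hne : gonVertex M i ≠ gonVertex M (i + 1) := by
      rw [Ne, gonVertex_eq_iff hM0]
      intro h
      have h1 : (M : ℤ) ∣ 1 := by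
        rwa [← dvd_neg, ← sub_add_cancel_left (i : ℤ) 1]
      have := Int.le_of_dvd one_pos h1
      omega
    refine ⟨(mem_regularGon hM0).2 ⟨_, rfl⟩, (mem_regularGon hM0).2 ⟨_, rfl⟩, hne, ?_⟩
    obtain ⟨V, -, hV⟩ := exists_finset_regularGon hM0
    have hn := isNormalAngle_arg (sub_ne_zero.2 hne.symm)
    have hext := extremePoints_convexHull_of_subset_sphere (regularGon_subset_sphere M)
    rw [← hV] at hext
    have hmem : ∀ k, gonVertex M k ∈ V := fun k => by
      rw [← Finset.mem_coe, hV]; exact (mem_regularGon hM0).2 ⟨_, rfl⟩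
    have hedge := (mem_edges_iff hext hn).2 ⟨hmem _, hmem _, fun z hz => ?_⟩
    · rw [hV] at hedge
      exact hedge.2.2.2
    · rw [← Finset.mem_coe, hV, mem_regularGon hM0] at hz
      obtain ⟨k, rfl⟩ := hz
      have h2 : 0 ≤ ((starRingEnd ℂ) (gonVertex M (i + 1) - gonVertex M i) *
          (gonVertex M k - gonVertex M i)).im := by
        rw [← hper i k, im_conj_gonVertex_sub_mul]
        have h0 := Int.emod_nonneg (k - i) hM'.ne'
        have h1 := Int.emod_lt_of_pos (k - i) hM'
        generalize (k - i) % (M : ℤ) = d at *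
        rw [show (i : ℤ) + 1 - i = 1 by ring, show (i : ℤ) + d - i = d by ring,
          show (i : ℤ) + d - (i + 1) = d - 1 by ring]
        rcases h0.eq_or_lt with rfl | h0
        · simp
        · have h3 := sin_pi_mul_div_nonneg (M := M) (k := 1) (by omega) (by omega)
          have h4 := sin_pi_mul_div_nonneg (M := M) (k := d) (by omega) (by omega)
          have h5 := sin_pi_mul_div_nonneg (M := M) (k := d - 1) (by omega) (by omega)
          positivity
      rw [im_conj_mul _, hn.1, zero_mul, zero_sub, neg_nonneg] at h2
      exact nonpos_of_mul_nonpos_right h2 hn.2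

theorem perimeter_regularGon {M : ℕ} (hM : 0 < M) :
    perimeter (convexHull ℝ (regularGon M)) = 2 * M * Real.sin (Real.pi / M) := by
  rcases (show 1 ≤ M from hM).eq_or_lt with rfl | hM2
  · obtain ⟨V, hc, hV⟩ := exists_finset_regularGon one_pos
    rw [← hV, perimeter_eq_zero_of_card_le_one _ hc.le]
    · simp
    · rw [hV]
      exact extremePoints_convexHull_of_subset_sphere (regularGon_subset_sphere 1)
  · have hinj : Function.Injective
        fun i : Fin M => (gonVertex M i, gonVertex M (i + 1)) := fun i j hij =>
      gonVertex_fin_injective hM (congrArg Prod.fst hij)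
    rw [perimeter, edges_regularGon hM2, finsum_mem_range hinj, finsum_eq_sum_of_fintype]
    have hlen : ∀ k : ℤ, ‖gonVertex M (k + 1) - gonVertex M k‖ = 2 * Real.sin (Real.pi / M) := by
      intro k
      have hs := sin_pi_mul_div_nonneg (M := M) (k := 1) (by omega) (by omega)
      rw [Int.cast_one, mul_one] at hs
      rw [gonVertex_add, ← mul_sub_one, norm_mul, norm_gonVertex, one_mul, gonVertex, mul_comm,
        Complex.norm_exp_I_mul_ofReal_sub_one, Int.cast_one, mul_one,
        show 2 * Real.pi / M / 2 = Real.pi / M by ring, Real.norm_of_nonneg (by positivity)]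
    simp only [hlen, Finset.sum_const, Finset.card_univ, Fintype.card_fin, nsmul_eq_mul]
    ring

/-! ### Sharpness for the regular polygon -/

/-- Among the values `x + 2 * π * k / M`, those in `[-π / M, π / M]` have the largest cosine. -/
theorem cos_add_two_pi_mul_div_le {M : ℕ} (hM : 0 < M) {x : ℝ} (hx : |x| ≤ Real.pi / M) (k : ℤ) :
    Real.cos (x + 2 * (Real.pi * k / M)) ≤ Real.cos x := by
  have hM' : (0 : ℤ) < M := by exact_mod_cast hM
  have hMr : (0 : ℝ) < M := by exact_mod_cast hM
  obtain ⟨x1, x2⟩ := abs_le.1 hx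
  have h0 := Int.emod_nonneg k hM'.ne'
  have h1 := Int.emod_lt_of_pos k hM'
  have hk : (k : ℝ) = (k % M : ℤ) + M * (k / M : ℤ) := by
    exact_mod_cast (Int.emod_add_mul_ediv k M).symm
  generalize k % (M : ℤ) = d at *
  have he : x + 2 * (Real.pi * k / M) =
      x + 2 * (Real.pi * d / M) + (k / M : ℤ) * (2 * Real.pi) := by
    rw [hk]; field_simp; ring
  rw [he, Real.cos_add_int_mul_two_pi]
  rcases h0.eq_or_lt with rfl | h0
  · simp
  have hs := sin_pi_mul_div_nonneg h0.le h1.le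
  have hd1 : (1 : ℝ) ≤ d := by exact_mod_cast h0
  have hd2 : (d : ℝ) ≤ M - 1 := by
    have : d ≤ M - 1 := by omega
    exact_mod_cast this
  have hb1 : Real.pi / M ≤ Real.pi * d / M := by
    gcongr; nlinarith [Real.pi_pos]
  have hb2 : Real.pi * d / M ≤ Real.pi - Real.pi / M := by
    rw [div_le_iff₀ hMr, sub_mul, div_mul_cancel₀ _ hMr.ne']; nlinarith [Real.pi_pos]
  have hs' : 0 ≤ Real.sin (x + Real.pi * d / M) :=
    Real.sin_nonneg_of_nonneg_of_le_pi (by linarith) (by linarith)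
  have hid : Real.cos (x + 2 * (Real.pi * d / M)) - Real.cos x =
      -2 * Real.sin (x + Real.pi * d / M) * Real.sin (Real.pi * d / M) := by
    rw [Real.cos_sub_cos,
      show (x + 2 * (Real.pi * d / M) + x) / 2 = x + Real.pi * d / M by ring,
      show (x + 2 * (Real.pi * d / M) - x) / 2 = Real.pi * d / M by ring]
  nlinarith [mul_nonneg hs' hs]

theorem norm_sum_gonVertex (M N : ℕ) (hMN : 2 ≤ M * N) :
    ‖∑ k ∈ Finset.range N, gonVertex (M * N) k‖ =
      Real.sin (Real.pi / M) / Real.sin (Real.pi / (M * N)) := by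
  have hN : 0 < N := Nat.pos_of_ne_zero (by rintro rfl; simp at hMN)
  have hM : 0 < M := Nat.pos_of_ne_zero (by rintro rfl; simp at hMN)
  have hpow : ∀ k : ℕ, gonVertex (M * N) k = gonVertex (M * N) 1 ^ k := fun k => by
    rw [gonVertex, gonVertex, ← Complex.exp_nat_mul]
    congr 1
    push_cast
    ring
  have hnorm : ∀ k : ℕ, k ≤ M * N → ‖gonVertex (M * N) k - 1‖ =
      2 * Real.sin (Real.pi * k / (M * N)) := fun k hk => by
    have hs := sin_pi_mul_div_nonneg (M := M * N) (k := k) (by positivity) (by exact_mod_cast hk)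
    push_cast at hs
    rw [gonVertex, mul_comm, Complex.norm_exp_I_mul_ofReal_sub_one]
    push_cast
    rw [show 2 * Real.pi * k / (M * N) / 2 = Real.pi * k / (M * N) by ring,
      Real.norm_of_nonneg (by positivity)]
  have hpos := sin_pi_mul_div_pos (M := M * N) (k := 1) one_pos (by exact_mod_cast hMN)
  push_cast at hpos
  rw [mul_one] at hpos
  have hgeom := congrArg norm (geom_sum_mul (gonVertex (M * N) 1) N)
  simp_rw [← hpow] at hgeom
  have h1 := hnorm 1 (by omega)
  rw [Nat.cast_one, Nat.cast_one, mul_one] at h1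
  have hNr : (N : ℝ) ≠ 0 := by exact_mod_cast hN.ne'
  rw [norm_mul, hnorm N (Nat.le_mul_of_pos_left N hM), h1, mul_div_mul_right _ _ hNr] at hgeom
  rw [eq_div_iff hpos.ne']
  linarith

theorem normalPart_gonVertex (M : ℕ) (θ : ℝ) (k : ℤ) :
    normalPart θ (gonVertex M k) = Real.cos (2 * Real.pi * k / M - θ) := by
  rw [normalPart, gonVertex, Complex.exp_ofReal_mul_I_re, Complex.exp_ofReal_mul_I_im,
    Real.cos_sub]

theorem normalPart_arg (z : ℂ) : normalPart z.arg z = ‖z‖ := by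
  have h1 : z.re = ‖z‖ * Real.cos z.arg := (Complex.norm_mul_cos_arg z).symm
  have h2 : z.im = ‖z‖ * Real.sin z.arg := (Complex.norm_mul_sin_arg z).symm
  rw [normalPart, h1, h2]
  linear_combination ‖z‖ * Real.sin_sq_add_cos_sq z.arg

/-- A sum of `M * N`-th roots of unity, one from each coset of the `M`-th roots, is at most as long
as the sum of `N` consecutive ones. -/
theorem norm_sum_gonVertex_coset_le {M N : ℕ} (hMN : 2 ≤ M * N) (k : Fin N → ℤ) :
    ‖∑ n : Fin N, gonVertex (M * N) (n + N * k n)‖ ≤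
      Real.sin (Real.pi / M) / Real.sin (Real.pi / (M * N)) := by
  have hN : 0 < N := Nat.pos_of_ne_zero (by rintro rfl; simp at hMN)
  have hM : 0 < M := Nat.pos_of_ne_zero (by rintro rfl; simp at hMN)
  have hN' : (0 : ℤ) < N := by exact_mod_cast hN
  have hNr : (0 : ℝ) < N := by exact_mod_cast hN
  have hMr : (0 : ℝ) < M := by exact_mod_cast hM
  rw [← normalPart_arg, ← norm_sum_gonVertex M N hMN]
  set θ := (∑ n : Fin N, gonVertex (M * N) (n + N * k n)).arg
  let c : ℝ := θ * (M * N) / (2 * Real.pi)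
  have hθ : θ = 2 * Real.pi * c / (M * N) := by
    simp only [c]; field_simp
  -- `c` is the direction `θ` measured in steps of the `M N`-gon. The block `J, …, J + N - 1` stays
  -- within `N / 2` steps of it, that is, within angle `π / M`.
  let J : ℤ := ⌈c - N / 2⌉
  have hJ1 : c - N / 2 ≤ J := Int.le_ceil _
  have hJ2 : (J : ℝ) < c - N / 2 + 1 := Int.ceil_lt_add_one _
  have hr0 : ∀ n : Fin N, 0 ≤ ((n : ℤ) - J) % N := fun n => Int.emod_nonneg _ hN'.ne'
  have hr1 : ∀ n : Fin N, ((n : ℤ) - J) % N < N := fun n => Int.emod_lt_of_pos _ hN'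
  -- `J + σ n` is the index in the block congruent to `n` mod `N`; its root is the member of the
  -- coset of `n` best aligned with `θ`.
  let σ : Fin N → Fin N := fun n => ⟨(((n : ℤ) - J) % N).toNat, by
    have := hr0 n; have := hr1 n; omega⟩
  have hσ : ∀ n, ((σ n : ℕ) : ℤ) = ((n : ℤ) - J) % N := fun n => Int.toNat_of_nonneg (hr0 n)
  have hinj : Function.Injective σ := fun n m hnm => by
    have h1 : ((n : ℤ) - J) % N = ((m : ℤ) - J) % N := by rw [← hσ, ← hσ, hnm]
    have h2 : (n : ℤ) % N = (m : ℤ) % N := by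
      have h3 : (n : ℤ) - J ≡ (m : ℤ) - J [ZMOD N] := h1
      have h4 := h3.add_right J
      rw [sub_add_cancel, sub_add_cancel] at h4
      exact h4
    rw [Int.emod_eq_of_lt (by positivity) (by exact_mod_cast n.2),
      Int.emod_eq_of_lt (by positivity) (by exact_mod_cast m.2)] at h2
    exact Fin.ext (by exact_mod_cast h2)
  have hterm : ∀ n, normalPart θ (gonVertex (M * N) (n + N * k n)) ≤
      normalPart θ (gonVertex (M * N) (J + (σ n : ℕ))) := by
    intro n
    have hdiv : (n : ℤ) - J = (σ n : ℕ) + N * (((n : ℤ) - J) / N) := by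
      rw [hσ]; exact (Int.emod_add_mul_ediv _ _).symm
    have hn : (n : ℤ) + N * k n = J + (σ n : ℕ) + N * (((n : ℤ) - J) / N + k n) := by
      linear_combination hdiv
    rw [normalPart_gonVertex, normalPart_gonVertex, hn]
    have hσ1 : ((σ n : ℕ) : ℝ) ≤ N - 1 := by
      have := (σ n).2
      have : ((σ n : ℕ) : ℤ) ≤ N - 1 := by omega
      exact_mod_cast this
    have hσ0 : (0 : ℝ) ≤ ((σ n : ℕ) : ℝ) := Nat.cast_nonneg _
    convert cos_add_two_pi_mul_div_le hM (x := 2 * Real.pi * (J + (σ n : ℕ) : ℤ) / (M * N : ℕ) - θ)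
      ?_ (((n : ℤ) - J) / N + k n) using 2
    · push_cast
      field_simp
      ring
    · rw [hθ]
      push_cast
      rw [← sub_div, ← mul_sub, abs_le]
      constructor
      · rw [le_div_iff₀ (by positivity), neg_mul, div_mul_eq_mul_div, mul_left_comm,
          mul_div_cancel_left₀ _ hMr.ne']
        nlinarith [Real.pi_pos]
      · rw [div_le_iff₀ (by positivity), div_mul_eq_mul_div, mul_left_comm,
          mul_div_cancel_left₀ _ hMr.ne']
        nlinarith [Real.pi_pos]
  calc normalPart θ (∑ n : Fin N, gonVertex (M * N) (n + N * k n))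
      = ∑ n : Fin N, normalPart θ (gonVertex (M * N) (n + N * k n)) := normalPart_sum _ _ _
    _ ≤ ∑ n : Fin N, normalPart θ (gonVertex (M * N) (J + (σ n : ℕ))) :=
        Finset.sum_le_sum fun n _ => hterm n
    _ = ∑ n : Fin N, normalPart θ (gonVertex (M * N) (J + (n : ℕ))) :=
        (Finite.injective_iff_bijective.1 hinj).sum_comp
          fun n : Fin N => normalPart θ (gonVertex (M * N) (J + (n : ℕ)))
    _ = normalPart θ (gonVertex (M * N) J * ∑ n : Fin N, gonVertex (M * N) (n : ℕ)) := by
        simp_rw [gonVertex_add, ← normalPart_sum, ← Finset.mul_sum]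
    _ ≤ ‖gonVertex (M * N) J * ∑ n : Fin N, gonVertex (M * N) (n : ℕ)‖ := normalPart_le_norm _ _
    _ = ‖∑ k ∈ Finset.range N, gonVertex (M * N) k‖ := by
        rw [norm_mul, norm_gonVertex, one_mul,
          Fin.sum_univ_eq_sum_range fun k => gonVertex (M * N) (k : ℕ)]

theorem gain_regularGon_gonVertex_le {M N : ℕ} (hMN : 2 ≤ M * N) :
    gain (regularGon M) (fun n : Fin N => gonVertex (M * N) n) ≤
      Real.sin (Real.pi / M) / Real.sin (Real.pi / (M * N)) := by
  have hN : 0 < N := Nat.pos_of_ne_zero (by rintro rfl; simp at hMN)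
  have hM : 0 < M := Nat.pos_of_ne_zero (by rintro rfl; simp at hMN)
  obtain ⟨w, hw, hgain⟩ := (isGreatest_gain (isCompact_regularGon M)
    ⟨_, (mem_regularGon hM).2 ⟨0, rfl⟩⟩ fun n : Fin N => gonVertex (M * N) n).1
  rw [← hgain]
  choose k hk using fun n => (mem_regularGon hM).1 (hw n)
  have hNc : (N : ℂ) ≠ 0 := by exact_mod_cast hN.ne'
  -- Multiplying by an `M`-th root of unity shifts the `M N`-gon index by a multiple of `N`, so each
  -- product stays in its coset.
  have hscale : ∀ j : ℤ, gonVertex M j = gonVertex (M * N) (N * j) := fun j => by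
    rw [gonVertex, gonVertex]
    congr 2
    push_cast
    rw [mul_left_comm, mul_comm (M : ℂ), mul_div_mul_left _ _ hNc]
  convert norm_sum_gonVertex_coset_le hMN k using 5 with n
  rw [gonVertex_add, ← hscale, hk, mul_comm]

end Beamforming

/-! ### Assembly of the theorem -/

theorem mainTheorem6 (M N : ℕ) (hMN : 2 ≤ M * N) :
    Beamforming.perimeter (convexHull ℝ (Beamforming.regularGon (M * N))) =
        2 * (M * N) * Real.sin (Real.pi / (M * N)) ∧
    (∀ W : Set ℂ, IsCompact W → W ⊆ Metric.closedBall 0 1 →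
      Beamforming.IsPolygon (convexHull ℝ W) M →
        (∀ h : Fin N → ℂ,
          Beamforming.perimeter (convexHull ℝ W) / (2 * (M * N) * Real.sin (Real.pi / (M * N))) *
            Beamforming.idealGain h ≤ Beamforming.gain W h) ∧
        (2 ≤ M → Beamforming.perimeter (convexHull ℝ W) / (2 * Real.pi) <
          Beamforming.perimeter (convexHull ℝ W) /
            (2 * (M * N) * Real.sin (Real.pi / (M * N))))) ∧
    Beamforming.perimeter (convexHull ℝ (Beamforming.regularGon M)) /
        (2 * (M * N) * Real.sin (Real.pi / (M * N))) =
      Real.sin (Real.pi / M) / (N * Real.sin (Real.pi / (M * N))) ∧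
    IsGreatest
      {c : ℝ | ∀ h : Fin N → ℂ,
        c * Beamforming.idealGain h ≤ Beamforming.gain (Beamforming.regularGon M) h}
      (Real.sin (Real.pi / M) / (N * Real.sin (Real.pi / (M * N)))) := by
  have hN : 0 < N := Nat.pos_of_ne_zero (by rintro rfl; simp at hMN)
  have hM : 0 < M := Nat.pos_of_ne_zero (by rintro rfl; simp at hMN)
  have hNr : (0 : ℝ) < N := by exact_mod_cast hN
  have hMr : (0 : ℝ) < M := by exact_mod_cast hM
  have hMNr : (2 : ℝ) ≤ M * N := by exact_mod_cast hMN
  have hpos : 0 < Real.sin (Real.pi / (M * N)) := by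
    refine Real.sin_pos_of_pos_of_lt_pi (by positivity) (div_lt_self Real.pi_pos (by linarith))
  have hD : 0 < 2 * (M * N) * Real.sin (Real.pi / (M * N)) := by positivity
  have hDlt : 2 * (M * N) * Real.sin (Real.pi / (M * N)) < 2 * Real.pi := by
    have h1 : Real.sin (Real.pi / (M * N)) < Real.pi / (M * N) := Real.sin_lt (by positivity)
    rw [lt_div_iff₀ (by positivity)] at h1
    linarith
  have hconst : Beamforming.perimeter (convexHull ℝ (Beamforming.regularGon M)) /
        (2 * (M * N) * Real.sin (Real.pi / (M * N))) =
      Real.sin (Real.pi / M) / (N * Real.sin (Real.pi / (M * N))) := by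
    rw [Beamforming.perimeter_regularGon hM]
    field_simp
  have hlower : ∀ W : Set ℂ, IsCompact W → Beamforming.IsPolygon (convexHull ℝ W) M →
      ∀ h : Fin N → ℂ,
        Beamforming.perimeter (convexHull ℝ W) / (2 * (M * N) * Real.sin (Real.pi / (M * N))) *
          Beamforming.idealGain h ≤ Beamforming.gain W h := by
    intro W hW hP h
    rw [div_mul_eq_mul_div, div_le_iff₀ hD, mul_comm (Beamforming.gain W h)]
    exact Beamforming.perimeter_mul_idealGain_le hMN hW hP h
  refine ⟨?_, fun W hW _ hP => ⟨hlower W hW hP, fun hM2 => ?_⟩, hconst, ?_, fun c hc => ?_⟩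
  · rw [Beamforming.perimeter_regularGon (by positivity)]
    push_cast
    rfl
  · obtain ⟨V, hcard, hVW, hV⟩ := hP
    rw [hVW] at hV ⊢
    exact div_lt_div_of_pos_left (Beamforming.perimeter_pos hV (by omega)) hD hDlt
  · rw [← hconst]
    exact hlower _ (Beamforming.isCompact_regularGon M) (Beamforming.isPolygon_regularGon hM)
  · have h1 := (hc fun n : Fin N => Beamforming.gonVertex (M * N) n).trans
      (Beamforming.gain_regularGon_gonVertex_le hMN)
    have h2 : Beamforming.idealGain (fun n : Fin N => Beamforming.gonVertex (M * N) n) = N := by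
      simp [Beamforming.idealGain, Beamforming.norm_gonVertex]
    rw [h2, ← le_div_iff₀ hNr, div_div, mul_comm (Real.sin (Real.pi / (M * N)))] at h1
    exact h1
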